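/- Fix a dimension $d\ge 1$, a communication radius $r\in(0,1/2]$, a noise rate $\eta\in(0,1/2)$ and $\delta>0$. Let $N$ sensors have independent locations $x_1,\dots,x_N$, uniform in the closed unit ball of $\mathbb{R}^d$. Let $w\in\mathbb{R}^d\setminus\{0\}$ and $b\in\mathbb{R}$; the target label of a point $x$ is positive if $w\cdot x>b$ and negative otherwise. Initially the label of each sensor is its target label flipped with probability exactly $\eta$, the flips being independent of each other and of the locations. When a sensor updates, it adopts the label held by the strict majority of the other sensors at distance at most $r$ from it; if there is a tie (for instance if there are no such sensors), its new label is given by a fixed but arbitrary rule depending only on its current label (for example, it keeps its label). In an asynchronous run along an ordering of the sensors, each sensor updates exactly once, one at a time, in that ordering, seeing the current labels. There is an absolute constant $c>0$ (independent of $d,r,\eta,\delta,N,w,b$ and the tie rule) such that, with $\phi=\min(\eta,\tfrac12-\eta)$, if $$N\ \ge\ \frac{16}{(cr)^d\phi^2}\left(\ln\frac{8}{(cr)^d\phi^2}+\ln\frac1\delta\right),$$ then with probability at least $1-\delta$ (over the locations and the initial labels) there exists an ordering of the sensors such that the asynchronous run along it leaves all sensors with the same label. Moreover, if $b=0$, then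 with probability at least $1-\delta$ an ordering by increasing $w\cdot x_i$ leaves all sensors with the negative label. -/

import Mathlib

open MeasureTheory

noncomputable section

namespace SensorConsensus

/-- The `d`-dimensional Euclidean space in which the sensors live. -/
abbrev Space (d : ℕ) := EuclideanSpace ℝ (Fin d)

/-- The state of a sensor: `true` is positive, `false` is negative. -/
abbrev Label := Bool

/-- The uniform probability distribution on the closed unit ball of `ℝ^d`. -/
def uniformBall (d : ℕ) : Measure (Space d) :=
  ProbabilityTheory.cond volume (Metric.closedBall (0 : Space d) 1)

/-- The law of one noise bit: `true` (the initial label is flipped) with probability `η`,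
`false` (the initial label is correct) with probability `1 - η`. -/
def noiseBit (η : ℝ) : Measure Bool :=
  ENNReal.ofReal η • Measure.dirac true + ENNReal.ofReal (1 - η) • Measure.dirac false

/-- An outcome of the random experiment with `N` sensors: the location and the noise bit of
each sensor. -/
abbrev Outcome (d N : ℕ) := Fin N → Space d × Bool

/-- The law of the experiment: the `N` locations are uniform in the unit ball, the `N` noise
bits have rate `η`, and all of these are independent. -/
def sensorLaw (d N : ℕ) (η : ℝ) : Measure (Outcome d N) :=
  Measure.pi fun _ => (uniformBall d).prod (noiseBit η)

/-- The target label of the point `x` for the linear separator `{x | ⟪w, x⟫ = b}`. -/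
def target {d : ℕ} (w : Space d) (b : ℝ) (x : Space d) : Label :=
  open Classical in decide (b < inner ℝ w x)

/-- The location of sensor `i`. -/
def location {d N : ℕ} (o : Outcome d N) (i : Fin N) : Space d := (o i).1

/-- The initial labels: the target label, flipped for those sensors whose noise bit is set. -/
def initialLabels {d N : ℕ} (w : Space d) (b : ℝ) (o : Outcome d N) : Fin N → Label :=
  fun i => if (o i).2 = true then !(target w b (location o i)) else target w b (location o i)

/-- The neighbors of sensor `i`: all the other sensors within distance `r` of it. -/
def neighbors {d N : ℕ} (r : ℝ) (x : Fin N → Space d) (i : Fin N) : Finset (Fin N) :=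
  open Classical in Finset.univ.filter fun j => j ≠ i ∧ dist (x i) (x j) ≤ r

/-- The number of neighbors of sensor `i` that are in the state `a`. -/
def votes {d N : ℕ} (r : ℝ) (x : Fin N → Space d) (s : Fin N → Label) (i : Fin N)
    (a : Label) : ℕ :=
  ((neighbors r x i).filter fun j => s j = a).card

/-- The state that sensor `i` adopts when it updates: the majority state among its neighbors;
in case of a tie (in particular with no neighbors) the rule `tie`, applied to its own current
state, decides (`tie = id`: the sensor keeps its state). -/
def majority {d N : ℕ} (tie : Label → Label) (r : ℝ) (x : Fin N → Space d)
    (s : Fin N → Label) (i : Fin N) : Label :=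
  if votes r x s i false < votes r x s i true then true
  else if votes r x s i true < votes r x s i false then false
  else tie (s i)

/-- One asynchronous move: sensor `i` updates, all other sensors keep their states. -/
def move {d N : ℕ} (tie : Label → Label) (r : ℝ) (x : Fin N → Space d)
    (s : Fin N → Label) (i : Fin N) : Fin N → Label :=
  Function.update s i (majority tie r x s i)

/-- The states after every sensor has updated once, one at a time, in the order
`σ 0, σ 1, …, σ (N - 1)`, starting from the states `s`. -/
def asyncRun {d N : ℕ} (tie : Label → Label) (r : ℝ) (x : Fin N → Space d)
    (s : Fin N → Label) (σ : Equiv.Perm (Fin N)) : Fin N → Label :=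
  (List.ofFn σ).foldl (move tie r x) s

/-- The states after the sensors have updated in the order `σ`, starting from their noisy
initial labels. -/
def finalLabels {d N : ℕ} (tie : Label → Label) (r : ℝ) (w : Space d) (b : ℝ)
    (o : Outcome d N) (σ : Equiv.Perm (Fin N)) : Fin N → Label :=
  asyncRun tie r (location o) (initialLabels w b o) σ

/-- `φ(η) = min(η, 1/2 - η)`. -/
def phi (η : ℝ) : ℝ := min η (1 / 2 - η)

end SensorConsensus

end

/-! Let `u` be a unit vector and suppose that every point with target label `!a` satisfies `β ≤ ⟪u,
y⟫`, where `0 ≤ β`. Sensors update by increasing `⟪u, x⟫`. As long as every update has produced `a`,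
a sensor `z` can only be outvoted by pending sensors, which are not below it and still hold their
initial label. So the dynamics is dominated by a static quantity, `margin`, which depends on the
data of two sensors only; positive margin sums at all sensors force consensus on `a`, with no ties
(`exists_perm_finalLabels_eq`).

Conditionally on one sensor, its margin sum has i.i.d. terms. Let A be the mass of its neighborhood
strictly below it, and B, C the masses of the rest with target `a`, `!a`. The mean margin is A + (1
- 2η)(B - C). Reflection across a hyperplane with the sensor and the origin on its lower side gives
C ≤ A + B, so the mean is at least 2ηA, and A is at least `(r / 16) ^ d` unless the sensor is low. A
sensor low enough to have C = 0 is handled directly. In all cases the mean is at least 2φ(r/16)^d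
(`le_integral_margin`).

The second moment is at most `r ^ d`, so a Bernstein-type bound gives failure probability exp(-Q(N -
1)) per sensor, with Q = (r/256)^d φ². A union bound over the sensors concludes. -/

namespace SensorConsensus

/-! ### Deterministic reduction to positive margins -/

/-- The vote margin in favour of `a` that the sensor `z'` is guaranteed to contribute when the
sensor `z` updates in the order of increasing `f`, where `L` gives the initial labels. -/
noncomputable def margin {d : ℕ} (r : ℝ) (f : Space d → ℝ) (L : Space d × Bool → Label) (a : Label)
    (z z' : Space d × Bool) : ℝ :=
  if dist z.1 z'.1 ≤ r then (if f z.1 ≤ f z'.1 ∧ L z' = !a then -1 else 1) else 0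

theorem mem_neighbors {d N : ℕ} {r : ℝ} {x : Fin N → Space d} {i j : Fin N} :
    j ∈ neighbors r x i ↔ j ≠ i ∧ dist (x i) (x j) ≤ r := by
  simp [neighbors]

/-- Summing margins over all other sensors compares the guaranteed votes. -/
theorem majority_eq_of_margin_pos {d N : ℕ} (tie : Label → Label) (r : ℝ) (f : Space d → ℝ)
    (L : Space d × Bool → Label) (a : Label) (o : Outcome d N) (i : Fin N)
    (h : 0 < ∑ j ∈ Finset.univ.erase i, margin r f L a (o i) (o j))
    (s : Fin N → Label)
    (hs : ∀ j, j ≠ i → s j = !a → f (o i).1 ≤ f (o j).1 ∧ L (o j) = !a) :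
    majority tie r (location o) s i = a := by
  classical
  have key : (votes r (location o) s i (!a) : ℝ) < votes r (location o) s i a := by
    have hsub : ∑ j ∈ Finset.univ.erase i, margin r f L a (o i) (o j) ≤
        ∑ j ∈ Finset.univ.erase i, ((if j ∈ (neighbors r (location o) i).filter
          (fun j => s j = a) then (1 : ℝ) else 0) -
          (if j ∈ (neighbors r (location o) i).filter (fun j => s j = !a) then (1 : ℝ) else 0)) := by
      refine Finset.sum_le_sum fun j hj => ?_
      have hji : j ≠ i := (Finset.mem_erase.1 hj).1
      have hsj := hs j hji
      by_cases hd : dist (o i).1 (o j).1 ≤ r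
      · have hm : j ∈ neighbors r (location o) i := mem_neighbors.2 ⟨hji, hd⟩
        have h1 : (!a) ≠ a := by cases a <;> simp
        simp only [margin, Finset.mem_filter, hm, true_and, if_pos hd]
        by_cases ha : s j = !a
        · rw [if_pos (hsj ha), if_neg (fun h => h1 (ha.symm.trans h)), if_pos ha]
          norm_num
        · have ha' : s j = a := by
            revert ha; cases s j <;> cases a <;> decide
          rw [if_neg ha, if_pos ha']
          split_ifs <;> norm_num
      · have hm : j ∉ neighbors r (location o) i := fun h => hd (mem_neighbors.1 h).2
        simp [margin, hm, hd]
    have hcount : ∀ c : Label, ∑ j ∈ Finset.univ.erase i,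
        (if j ∈ (neighbors r (location o) i).filter (fun j => s j = c) then (1 : ℝ) else 0) =
          votes r (location o) s i c := by
      intro c
      rw [votes, ← Finset.sum_filter, Finset.sum_const, nsmul_eq_mul, mul_one]
      congr 2
      ext j
      simp only [neighbors, Finset.mem_filter, Finset.mem_erase, Finset.mem_univ]
      tauto
    rw [Finset.sum_sub_distrib, hcount, hcount] at hsub
    linarith
  have key' : votes r (location o) s i (!a) < votes r (location o) s i a := by exact_mod_cast key
  unfold majority
  cases a
  · simp only [Bool.not_false] at key'
    rw [if_neg (by omega), if_pos key']
  · simp only [Bool.not_true] at key'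
    rw [if_pos key']

/-- Invariant of the run: a sensor holding `!a` is still pending and held `!a` initially. Each
update produces `a`, so the invariant passes to the tail of the list; at the empty list nobody holds
`!a`. -/
theorem foldl_move_eq {d N : ℕ} (tie : Label → Label) (r : ℝ) (f : Space d → ℝ)
    (L : Space d × Bool → Label) (a : Label) (o : Outcome d N)
    (h : ∀ i, 0 < ∑ j ∈ Finset.univ.erase i, margin r f L a (o i) (o j))
    (l : List (Fin N)) (hl : l.Pairwise fun i j => f (o i).1 ≤ f (o j).1)
    (s : Fin N → Label) (hs : ∀ j, s j = !a → j ∈ l ∧ L (o j) = !a) (i : Fin N) :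
    l.foldl (move tie r (location o)) s i = a := by
  induction l generalizing s with
  | nil =>
    have := hs i
    simp only [List.not_mem_nil, false_and, imp_false] at this
    simp only [List.foldl_nil]
    revert this; cases s i <;> cases a <;> simp
  | cons k l ih =>
    rw [List.foldl_cons]
    rw [List.pairwise_cons] at hl
    have hmaj : majority tie r (location o) s k = a := by
      refine majority_eq_of_margin_pos tie r f L a o k (h k) s fun j hjk hj => ?_
      obtain ⟨hj1, hj2⟩ := hs j hj
      exact ⟨hl.1 j ((List.mem_cons.1 hj1).resolve_left hjk), hj2⟩
    refine ih hl.2 _ fun j hj => ?_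
    have hjk : j ≠ k := by
      rintro rfl
      rw [move, Function.update_self, hmaj] at hj
      cases a <;> simp at hj
    rw [move, Function.update_of_ne hjk] at hj
    obtain ⟨hj1, hj2⟩ := hs j hj
    exact ⟨(List.mem_cons.1 hj1).resolve_left hjk, hj2⟩

/-- If all margins are positive, the run in the order of increasing `f` ends in consensus. -/
theorem exists_perm_finalLabels_eq {d N : ℕ} (tie : Label → Label) (r : ℝ) (w : Space d) (b : ℝ)
    (f : Space d → ℝ) (a : Label) (o : Outcome d N)
    (h : ∀ i, 0 < ∑ j ∈ Finset.univ.erase i, margin r f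
      (fun z => if z.2 = true then !(target w b z.1) else target w b z.1) a (o i) (o j)) :
    ∃ σ : Equiv.Perm (Fin N), Monotone (fun k => f (location o (σ k))) ∧
      ∀ i, finalLabels tie r w b o σ i = a := by
  let σ := Tuple.sort fun i => f (location o i)
  have hσ : Monotone (fun k => f (location o (σ k))) :=
    Tuple.monotone_sort fun i => f (location o i)
  refine ⟨σ, hσ, fun i => ?_⟩
  refine foldl_move_eq tie r f _ a o h _ ?_ _ (fun j hj => ⟨?_, hj⟩) i
  · rw [List.pairwise_ofFn]
    exact fun i j hij => hσ hij.le
  · exact (List.mem_ofFn' _ _).2 ⟨σ.symm j, by simp⟩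

/-! ### Concentration and the union bound -/

/-- A second-order bound for the moment generating function of a variable with values in
`[-1, 1]`. -/
theorem integral_exp_neg_mul_le {E : Type*} [MeasurableSpace E] (ν : Measure E)
    [IsProbabilityMeasure ν] {Z : E → ℝ} (hZ : Measurable Z) (hb : ∀ y, |Z y| ≤ 1) {t : ℝ}
    (h0 : 0 ≤ t) (h1 : t ≤ 1) :
    ∫ y, Real.exp (-t * Z y) ∂ν ≤ Real.exp (-t * ∫ y, Z y ∂ν + t ^ 2 * ∫ y, Z y ^ 2 ∂ν) := by
  have hZi : Integrable Z ν :=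
    Integrable.of_bound hZ.aestronglyMeasurable 1 (Filter.Eventually.of_forall hb)
  have hZ2 : Integrable (fun y => Z y ^ 2) ν := by
    refine Integrable.of_bound (hZ.pow_const 2).aestronglyMeasurable 1
      (Filter.Eventually.of_forall fun y => ?_)
    rw [Real.norm_eq_abs, abs_pow]
    exact pow_le_one₀ (abs_nonneg _) (hb y)
  have hpt : ∀ y, Real.exp (-t * Z y) ≤ 1 + -t * Z y + t ^ 2 * Z y ^ 2 := by
    intro y
    have h : |-t * Z y| ≤ 1 := by
      rw [abs_mul, abs_neg, abs_of_nonneg h0]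
      exact mul_le_one₀ h1 (abs_nonneg _) (hb y)
    have := (abs_le.1 (Real.abs_exp_sub_one_sub_id_le h)).2
    nlinarith
  have hlin : Integrable (fun y => 1 + -t * Z y) ν := (integrable_const 1).add (hZi.const_mul (-t))
  have hint : Integrable (fun y => 1 + -t * Z y + t ^ 2 * Z y ^ 2) ν :=
    hlin.add (hZ2.const_mul (t ^ 2))
  calc ∫ y, Real.exp (-t * Z y) ∂ν
      ≤ ∫ y, (1 + -t * Z y + t ^ 2 * Z y ^ 2) ∂ν :=
        integral_mono_of_nonneg (Filter.Eventually.of_forall fun y => (Real.exp_pos _).le) hint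
          (Filter.Eventually.of_forall hpt)
    _ = 1 + (-t * ∫ y, Z y ∂ν + t ^ 2 * ∫ y, Z y ^ 2 ∂ν) := by
        rw [integral_add hlin (hZ2.const_mul (t ^ 2)),
          integral_add (integrable_const 1) (hZi.const_mul (-t)), integral_const_mul,
          integral_const_mul, integral_const, probReal_univ, smul_eq_mul]
        ring
    _ ≤ _ := by
        rw [add_comm]
        exact Real.add_one_le_exp _

/-- Chernoff bound for a sum of independent copies of a bounded variable. -/
theorem measure_pi_sum_nonpos_le {E : Type*} [MeasurableSpace E] (ν : Measure E)
    [IsProbabilityMeasure ν] {Z : E → ℝ} (hZ : Measurable Z) (hb : ∀ y, |Z y| ≤ 1) {t p : ℝ}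
    (h0 : 0 ≤ t) (hp : ∫ y, Real.exp (-t * Z y) ∂ν ≤ p) (n : ℕ) :
    Measure.pi (fun _ : Fin n => ν) {y | ∑ k, Z (y k) ≤ 0} ≤ ENNReal.ofReal (p ^ n) := by
  have hm : Measurable fun y : Fin n → E => ∏ k, Real.exp (-t * Z (y k)) := by fun_prop
  have hint : Integrable (fun y : Fin n → E => ∏ k, Real.exp (-t * Z (y k)))
      (Measure.pi fun _ : Fin n => ν) := by
    refine Integrable.of_bound hm.aestronglyMeasurable (∏ _k : Fin n, Real.exp t)
      (Filter.Eventually.of_forall fun y => ?_)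
    rw [Real.norm_of_nonneg (Finset.prod_nonneg fun _ _ => (Real.exp_pos _).le)]
    refine Finset.prod_le_prod (fun _ _ => (Real.exp_pos _).le) fun k _ => ?_
    refine Real.exp_le_exp.2 ?_
    nlinarith [(abs_le.1 (hb (y k))).1]
  have hmarkov := mul_meas_ge_le_integral_of_nonneg (Filter.Eventually.of_forall
    fun y => Finset.prod_nonneg fun _ _ => (Real.exp_pos _).le) hint 1
  rw [integral_fintype_prod_eq_prod (𝕜 := ℝ) (fun (_ : Fin n) y => Real.exp (-t * Z y)),
    Finset.prod_const, Finset.card_univ, Fintype.card_fin, one_mul] at hmarkov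
  have hsub : {y : Fin n → E | ∑ k, Z (y k) ≤ 0} ⊆
      {y | 1 ≤ ∏ k, Real.exp (-t * Z (y k))} := by
    intro y hy
    simp only [Set.mem_ofPred_eq] at hy ⊢
    rw [← Real.exp_sum, Real.one_le_exp_iff, ← Finset.mul_sum]
    nlinarith
  refine (measure_mono hsub).trans ?_
  rw [← ofReal_measureReal]
  refine ENNReal.ofReal_le_ofReal (hmarkov.trans ?_)
  exact pow_le_pow_left₀ (integral_nonneg fun _ => (Real.exp_pos _).le) hp n

/-- The Chernoff bound for the sum of `g (o i) (o j)` over `j ≠ i`, conditionally on `o i`. -/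
theorem measure_pi_sum_erase_nonpos_le {E : Type*} [MeasurableSpace E] (ν : Measure E)
    [IsProbabilityMeasure ν] {g : E → E → ℝ} (hg : Measurable (Function.uncurry g))
    (hb : ∀ x y, |g x y| ≤ 1) {t p : ℝ} (h0 : 0 ≤ t)
    (hp : ∀ᵐ x ∂ν, ∫ y, Real.exp (-t * g x y) ∂ν ≤ p) {N : ℕ} (i : Fin N) :
    Measure.pi (fun _ : Fin N => ν) {o | ∑ j ∈ Finset.univ.erase i, g (o i) (o j) ≤ 0} ≤
      ENNReal.ofReal (p ^ (N - 1)) := by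
  obtain _ | n := N
  · exact i.elim0
  let S : Set (E × (Fin n → E)) := {q | ∑ k, g q.1 (q.2 k) ≤ 0}
  have hS : MeasurableSet S := by
    refine measurableSet_le (Finset.measurable_sum _ fun k _ => ?_) measurable_const
    exact hg.comp (measurable_fst.prodMk ((measurable_pi_apply k).comp measurable_snd))
  have hpre : {o : Fin (n + 1) → E | ∑ j ∈ Finset.univ.erase i, g (o i) (o j) ≤ 0} =
      MeasurableEquiv.piFinSuccAbove (fun _ => E) i ⁻¹' S := by
    ext o
    have h1 := Finset.add_sum_erase Finset.univ (fun j => g (o i) (o j)) (Finset.mem_univ i)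
    rw [Fin.sum_univ_succAbove _ i] at h1
    have h2 : ∑ j ∈ Finset.univ.erase i, g (o i) (o j) = ∑ k, g (o i) (o (i.succAbove k)) := by
      linarith
    simp only [Set.mem_ofPred_eq, h2]
    rfl
  rw [hpre, (measurePreserving_piFinSuccAbove (fun _ => ν) i).measure_preimage
    hS.nullMeasurableSet, Measure.prod_apply hS]
  calc ∫⁻ x, Measure.pi (fun _ : Fin n => ν) (Prod.mk x ⁻¹' S) ∂ν
      ≤ ∫⁻ _, ENNReal.ofReal (p ^ n) ∂ν := by
        refine lintegral_mono_ae ?_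
        filter_upwards [hp] with x hx
        exact measure_pi_sum_nonpos_le ν hg.of_uncurry_left (hb x) h0 hx n
    _ = ENNReal.ofReal (p ^ (n + 1 - 1)) := by simp

/-- The union bound: outside an event of probability `N * p ^ (N - 1)`, all sums are positive. -/
theorem le_measureReal_of_sum_erase_pos {E : Type*} [MeasurableSpace E] (ν : Measure E)
    [IsProbabilityMeasure ν] {g : E → E → ℝ} (hg : Measurable (Function.uncurry g))
    (hb : ∀ x y, |g x y| ≤ 1) {t p : ℝ} (h0 : 0 ≤ t) (hp0 : 0 ≤ p)
    (hp : ∀ᵐ x ∂ν, ∫ y, Real.exp (-t * g x y) ∂ν ≤ p) {N : ℕ} {S : Set (Fin N → E)}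
    (hS : ∀ o, (∀ i, 0 < ∑ j ∈ Finset.univ.erase i, g (o i) (o j)) → o ∈ S) :
    1 - N * p ^ (N - 1) ≤ (Measure.pi fun _ : Fin N => ν).real S := by
  have hcompl : Sᶜ ⊆ ⋃ i : Fin N, {o | ∑ j ∈ Finset.univ.erase i, g (o i) (o j) ≤ 0} := by
    intro o ho
    by_contra h
    simp only [Set.mem_iUnion, Set.mem_ofPred_eq, not_exists, not_le] at h
    exact ho (hS o h)
  have h1 : (Measure.pi fun _ : Fin N => ν) Sᶜ ≤ ENNReal.ofReal (N * p ^ (N - 1)) := by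
    refine (measure_mono hcompl).trans ((measure_iUnion_le _).trans ?_)
    rw [tsum_fintype]
    refine (Finset.sum_le_sum fun i _ =>
      measure_pi_sum_erase_nonpos_le ν hg hb h0 hp i).trans_eq ?_
    rw [Finset.sum_const, Finset.card_univ, Fintype.card_fin, nsmul_eq_mul,
      ENNReal.ofReal_mul (Nat.cast_nonneg _), ENNReal.ofReal_natCast]
  have h2 : (Measure.pi fun _ : Fin N => ν).real Sᶜ ≤ N * p ^ (N - 1) :=
    ENNReal.toReal_le_of_le_ofReal (by positivity) h1
  -- Subadditivity replaces the complement formula, so `S` need not be measurable.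
  have h3 := measureReal_union_le (μ := Measure.pi fun _ : Fin N => ν) S Sᶜ
  rw [Set.union_compl_self, probReal_univ] at h3
  linarith

/-- The sample size suffices for the union bound. -/
theorem natCast_mul_exp_pow_le {N : ℕ} {Q δ : ℝ} (hQ : 0 < Q) (hQ1 : Q ≤ 1) (hδ : 0 < δ)
    (hδ1 : δ ≤ 1) (hN : 16 / Q * (Real.log (8 / Q) + Real.log (1 / δ)) ≤ N) :
    N * Real.exp (-Q) ^ (N - 1) ≤ δ := by
  have hlog8 : 1 ≤ Real.log (8 / Q) := by
    rw [Real.le_log_iff_exp_le (by positivity), le_div_iff₀ hQ]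
    nlinarith [Real.exp_one_lt_d9, Real.exp_pos 1]
  have hlogδ : 0 ≤ Real.log (1 / δ) := Real.log_nonneg (by rw [le_div_iff₀ hδ]; linarith)
  have hNQ : 16 * (Real.log (8 / Q) + Real.log (1 / δ)) ≤ N * Q := by
    rw [div_mul_eq_mul_div, div_le_iff₀ hQ] at hN
    exact hN
  have hN2 : (2 : ℝ) ≤ N := by
    have : (0 : ℝ) ≤ N := Nat.cast_nonneg N
    nlinarith
  have hN1 : 1 ≤ N := by
    have : 2 ≤ N := by exact_mod_cast hN2
    omega
  -- The exponent is at least `N * Q / 2`, as `2 ≤ N`. One quarter `N * Q / 4` absorbs the factor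
  -- `N`; the other supplies `δ` and cancels the resulting `4 / Q`.
  have h1 : (N : ℝ) ≤ 4 / Q * Real.exp (N * Q / 4) := by
    have := Real.add_one_le_exp (N * Q / 4)
    rw [div_mul_eq_mul_div, le_div_iff₀ hQ]
    linarith
  have h2 : Real.exp (-(N * Q / 4)) ≤ Q / 8 * δ := by
    have : Q / 8 * δ = Real.exp (-(Real.log (8 / Q) + Real.log (1 / δ))) := by
      rw [Real.exp_neg, Real.exp_add, Real.exp_log (by positivity), Real.exp_log (by positivity)]
      field_simp
    rw [this]
    refine Real.exp_le_exp.2 ?_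
    linarith
  have h3 : Real.exp (-Q) ^ (N - 1) ≤ Real.exp (-(N * Q / 4)) * Real.exp (-(N * Q / 4)) := by
    rw [← Real.exp_nat_mul, ← Real.exp_add, Nat.cast_sub hN1]
    refine Real.exp_le_exp.2 ?_
    push_cast
    nlinarith
  calc N * Real.exp (-Q) ^ (N - 1)
      ≤ (4 / Q * Real.exp (N * Q / 4)) * (Real.exp (-(N * Q / 4)) * Real.exp (-(N * Q / 4))) :=
        mul_le_mul h1 h3 (by positivity) (by positivity)
    _ = 4 / Q * Real.exp (-(N * Q / 4)) := by
        rw [Real.exp_neg]; field_simp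
    _ ≤ 4 / Q * (Q / 8 * δ) := by gcongr
    _ = δ / 2 := by field_simp; norm_num
    _ ≤ δ := by linarith

/-! ### Geometry of the uniform distribution on the ball -/

theorem volume_closedBall_one_pos (d : ℕ) : 0 < volume (Metric.closedBall (0 : Space d) 1) :=
  Metric.measure_closedBall_pos _ _ one_pos

instance isProbabilityMeasure_uniformBall (d : ℕ) : IsProbabilityMeasure (uniformBall d) :=
  ProbabilityTheory.cond_isProbabilityMeasure_of_finite (volume_closedBall_one_pos d).ne'
    measure_closedBall_lt_top.ne

theorem uniformBall_le_of_volume_le {d : ℕ} {S T : Set (Space d)}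
    (h : volume (Metric.closedBall (0 : Space d) 1 ∩ S) ≤
      volume (Metric.closedBall (0 : Space d) 1 ∩ T)) :
    (uniformBall d).real S ≤ (uniformBall d).real T := by
  refine ENNReal.toReal_mono (measure_ne_top _ _) ?_
  rw [uniformBall, ProbabilityTheory.cond_apply Metric.isClosed_closedBall.measurableSet,
    ProbabilityTheory.cond_apply Metric.isClosed_closedBall.measurableSet]
  gcongr

theorem uniformBall_real_apply {d : ℕ} (S : Set (Space d)) :
    (uniformBall d).real S * volume.real (Metric.closedBall (0 : Space d) 1) =
      volume.real (Metric.closedBall (0 : Space d) 1 ∩ S) := by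
  have h0 : volume.real (Metric.closedBall (0 : Space d) 1) ≠ 0 :=
    (ENNReal.toReal_pos (volume_closedBall_one_pos d).ne' measure_closedBall_lt_top.ne).ne'
  rw [uniformBall, measureReal_def,
    ProbabilityTheory.cond_apply Metric.isClosed_closedBall.measurableSet, ENNReal.toReal_mul,
    ENNReal.toReal_inv, ← measureReal_def, ← measureReal_def]
  field_simp

theorem volume_real_closedBall {d : ℕ} (x : Space d) {ρ : ℝ} (hρ : 0 ≤ ρ) :
    volume.real (Metric.closedBall x ρ) =
      ρ ^ d * volume.real (Metric.closedBall (0 : Space d) 1) := by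
  rw [measureReal_def, Measure.addHaar_closedBall' _ _ hρ, ENNReal.toReal_mul,
    ENNReal.toReal_ofReal (by positivity), finrank_euclideanSpace_fin, ← measureReal_def]

theorem uniformBall_real_closedBall_le {d : ℕ} (x : Space d) {ρ : ℝ} (hρ : 0 ≤ ρ) :
    (uniformBall d).real (Metric.closedBall x ρ) ≤ ρ ^ d := by
  have h0 : 0 < volume.real (Metric.closedBall (0 : Space d) 1) :=
    ENNReal.toReal_pos (volume_closedBall_one_pos d).ne' measure_closedBall_lt_top.ne
  refine le_of_mul_le_mul_right ?_ h0
  rw [uniformBall_real_apply, ← volume_real_closedBall x hρ]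
  exact measureReal_mono Set.inter_subset_right measure_closedBall_lt_top.ne

theorem pow_le_uniformBall_real {d : ℕ} {p : Space d} {ρ : ℝ} (hρ : 0 ≤ ρ) {S : Set (Space d)}
    (h1 : Metric.closedBall p ρ ⊆ Metric.closedBall 0 1) (h2 : Metric.closedBall p ρ ⊆ S) :
    ρ ^ d ≤ (uniformBall d).real S := by
  have h0 : 0 < volume.real (Metric.closedBall (0 : Space d) 1) :=
    ENNReal.toReal_pos (volume_closedBall_one_pos d).ne' measure_closedBall_lt_top.ne
  refine le_of_mul_le_mul_right ?_ h0
  rw [uniformBall_real_apply, ← volume_real_closedBall p hρ]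
  exact measureReal_mono (Set.subset_inter h1 h2)
    (measure_ne_top_of_subset Set.inter_subset_left measure_closedBall_lt_top.ne)

theorem ae_norm_le_one_uniformBall (d : ℕ) : ∀ᵐ x ∂uniformBall d, ‖x‖ ≤ 1 := by
  have := ProbabilityTheory.ae_cond_mem (μ := (volume : Measure (Space d)))
    (s := Metric.closedBall (0 : Space d) 1) Metric.isClosed_closedBall.measurableSet
  filter_upwards [this] with x hx
  simpa using hx

/-- Covers the mirror hyperplane itself, which the strict inequalities of the reflection bound leave
out. -/
theorem uniformBall_hyperplane {d : ℕ} {u : Space d} (hu : ‖u‖ = 1) (m : ℝ) :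
    (uniformBall d).real {y | inner ℝ u y = m} = 0 := by
  have huu : inner ℝ u u = 1 := by rw [real_inner_self_eq_norm_sq, hu, one_pow]
  let s : AffineSubspace ℝ (Space d) :=
    AffineSubspace.mk' (m • u) (LinearMap.ker (innerSL ℝ u).toLinearMap)
  have hs : (s : Set (Space d)) = {y | inner ℝ u y = m} := by
    ext y
    simp only [s, SetLike.mem_coe, AffineSubspace.mem_mk', LinearMap.mem_ker, Set.mem_ofPred_eq]
    simp [inner_sub_right, inner_smul_right, hu, sub_eq_zero]
  have htop : s ≠ ⊤ := by
    intro h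
    have : (m + 1) • u ∈ (s : Set (Space d)) := by rw [h]; trivial
    rw [hs] at this
    simp [inner_smul_right, hu] at this
  have h := Measure.addHaar_affineSubspace (volume : Measure (Space d)) s htop
  rw [hs] at h
  have h' := ProbabilityTheory.cond_absolutelyContinuous
    (μ := (volume : Measure (Space d))) (s := Metric.closedBall (0 : Space d) 1) h
  rw [measureReal_def, uniformBall, h', ENNReal.toReal_zero]

/-- Reflecting across a hyperplane that has `x` and the origin on its lower side shows that the
part of the neighborhood of `x` below the hyperplane is at least as likely as the part above. -/
theorem uniformBall_above_le_below {d : ℕ} {u : Space d} (hu : ‖u‖ = 1) {m : ℝ} (hm : 0 ≤ m)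
    {x : Space d} (hx : inner ℝ u x ≤ m) (r : ℝ) :
    (uniformBall d).real {y | dist x y ≤ r ∧ m < inner ℝ u y} ≤
      (uniformBall d).real {y | dist x y ≤ r ∧ inner ℝ u y < m} := by
  have huu : inner ℝ u u = 1 := by rw [real_inner_self_eq_norm_sq, hu, one_pow]
  let R : Space d → Space d := fun y => (ℝ ∙ u)ᗮ.reflection y + (2 * m) • u
  have hRapp : ∀ y, R y = y - (2 * (inner ℝ u y - m)) • u := by
    intro y
    simp only [R, Submodule.reflection_orthogonal_apply, Submodule.reflection_singleton_apply, hu]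
    simp only [RCLike.ofReal_real_eq_id, id, one_pow, div_one]
    module
  have hR : MeasurePreserving R volume volume :=
    (measurePreserving_add_right volume ((2 * m) • u)).comp
      (LinearIsometryEquiv.measurePreserving (ℝ ∙ u)ᗮ.reflection)
  have hmeas : MeasurableSet {y : Space d | dist x y ≤ r ∧ inner ℝ u y < m} :=
    (measurableSet_le (f := fun y => dist x y) (by fun_prop) measurable_const).inter
      (measurableSet_lt (f := fun y => inner ℝ u y) (by fun_prop) measurable_const)
  refine uniformBall_le_of_volume_le ?_
  rw [← hR.measure_preimage
    (Metric.isClosed_closedBall.measurableSet.inter hmeas).nullMeasurableSet]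
  -- For a point above the mirror, `R` decreases its distance to `x` and does not increase its norm,
  -- because `x` and the origin lie on the lower side (`e1`, `e2`).
  refine measure_mono ?_
  rintro y ⟨hy1, hy2, hy3⟩
  rw [mem_closedBall_zero_iff] at hy1
  have e1 : ‖R y‖ ^ 2 = ‖y‖ ^ 2 - 4 * (inner ℝ u y - m) * m := by
    rw [hRapp, norm_sub_sq_real, norm_smul, hu, inner_smul_right, real_inner_comm, mul_one,
      Real.norm_eq_abs, sq_abs]
    ring
  have e2 : dist x (R y) ^ 2 =
      dist x y ^ 2 + 4 * (inner ℝ u y - m) * (inner ℝ u x - m) := by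
    have : x - R y = (x - y) + (2 * (inner ℝ u y - m)) • u := by rw [hRapp]; abel
    rw [dist_eq_norm, dist_eq_norm, this, norm_add_sq_real, norm_smul, hu, inner_smul_right,
      real_inner_comm u (x - y), mul_one, Real.norm_eq_abs, sq_abs, inner_sub_right]
    ring
  have e3 : inner ℝ u (R y) = 2 * m - inner ℝ u y := by
    rw [hRapp, inner_sub_right, inner_smul_right, huu]
    ring
  refine ⟨?_, ?_, ?_⟩
  · rw [mem_closedBall_zero_iff]
    refine (pow_le_pow_iff_left₀ (norm_nonneg _) zero_le_one two_ne_zero).1 ?_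
    rw [e1]
    nlinarith [norm_nonneg y]
  · refine le_trans ((pow_le_pow_iff_left₀ dist_nonneg dist_nonneg two_ne_zero).1 ?_) hy2
    rw [e2]
    nlinarith
  · rw [e3]
    linarith

/-- A ball of radius `r / 16` inside the neighborhood of a point `x` of the unit ball, which lies
strictly below `x` unless `x` itself is close to the lowest point. -/
theorem exists_closedBall_subset {d : ℕ} {u : Space d} (hu : ‖u‖ = 1) {r : ℝ} (hr : 0 < r)
    (hr1 : r ≤ 1 / 2) {x : Space d} (hx : ‖x‖ ≤ 1) :
    ∃ p : Space d, ∀ y ∈ Metric.closedBall p (r / 16), ‖y‖ ≤ 1 ∧ dist x y ≤ r ∧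
      (-1 / 2 ≤ inner ℝ u x → inner ℝ u y < inner ℝ u x) := by
  have huu : inner ℝ u u = 1 := by rw [real_inner_self_eq_norm_sq, hu, one_pow]
  -- The ball of radius 1/8 about `-(3/4) u` lies in the unit ball, at height at most -5/8. The
  -- homothety with center `x` and ratio `r / 2` maps it to the desired ball: convexity keeps it in
  -- the unit ball, and points move by at most `(r / 2) * 2`.
  refine ⟨x + (r / 2) • ((-(3 / 4 : ℝ)) • u - x), fun y hy => ?_⟩
  obtain ⟨v, rfl⟩ : ∃ v, y = x + (r / 2) • ((-(3 / 4 : ℝ)) • u + v - x) :=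
    ⟨(2 / r) • (y - x) + x + (3 / 4 : ℝ) • u, by
      have : (r / 2) * (2 / r) = 1 := by field_simp
      simp only [smul_add, smul_sub, smul_smul, this, neg_smul, one_smul]
      module⟩
  have hv : ‖v‖ ≤ 1 / 8 := by
    rw [Metric.mem_closedBall, dist_eq_norm] at hy
    have : x + (r / 2) • ((-(3 / 4 : ℝ)) • u + v - x) -
        (x + (r / 2) • ((-(3 / 4 : ℝ)) • u - x)) = (r / 2) • v := by module
    rw [this, norm_smul, Real.norm_of_nonneg (by positivity)] at hy
    nlinarith
  set z := (-(3 / 4 : ℝ)) • u + v with hz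
  have hz1 : ‖z‖ ≤ 1 := by
    refine (norm_add_le _ _).trans ?_
    rw [norm_smul, hu, norm_neg, Real.norm_of_nonneg (by norm_num)]
    linarith
  have hzu : inner ℝ u z ≤ -(5 / 8) := by
    have := real_inner_le_norm u v
    rw [hu, one_mul] at this
    rw [hz, inner_add_right, inner_smul_right, huu]
    linarith
  refine ⟨?_, ?_, fun ht => ?_⟩
  · have : x + (r / 2) • (z - x) = (1 - r / 2) • x + (r / 2) • z := by module
    rw [this]
    refine (norm_add_le _ _).trans ?_
    rw [norm_smul, norm_smul, Real.norm_of_nonneg (by linarith), Real.norm_of_nonneg (by linarith)]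
    nlinarith
  · rw [dist_eq_norm, sub_add_cancel_left, norm_neg, norm_smul, Real.norm_of_nonneg (by linarith)]
    have := norm_sub_le z x
    nlinarith
  · rw [inner_add_right, inner_smul_right, inner_sub_right]
    nlinarith

/-! ### Moments of the margin -/

theorem isProbabilityMeasure_noiseBit {η : ℝ} (h0 : 0 ≤ η) (h1 : η ≤ 1) :
    IsProbabilityMeasure (noiseBit η) := by
  refine ⟨?_⟩
  simp only [noiseBit, Measure.coe_add, Measure.coe_smul, Pi.add_apply, Pi.smul_apply,
    measure_univ, smul_eq_mul, mul_one]
  rw [← ENNReal.ofReal_add h0 (by linarith)]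
  simp

theorem integral_noiseBit {η : ℝ} (h0 : 0 ≤ η) (h1 : η ≤ 1) (F : Bool → ℝ) :
    ∫ n, F n ∂noiseBit η = η * F true + (1 - η) * F false := by
  have hi : ∀ c : Bool, Integrable F (Measure.dirac c) := fun c => Integrable.of_finite
  rw [noiseBit, integral_add_measure ((hi _).smul_measure ENNReal.ofReal_ne_top)
    ((hi _).smul_measure ENNReal.ofReal_ne_top), integral_smul_measure, integral_smul_measure,
    integral_dirac, integral_dirac, ENNReal.toReal_ofReal h0,
    ENNReal.toReal_ofReal (by linarith), smul_eq_mul, smul_eq_mul]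

/-- The noisy label for the noiseless labelling `T`. -/
def noisyLabel {d : ℕ} (T : Space d → Label) (z : Space d × Bool) : Label :=
  if z.2 = true then !(T z.1) else T z.1

theorem measurable_noisyLabel {d : ℕ} {T : Space d → Label} (hT : Measurable T) :
    Measurable (noisyLabel T) := by
  have hT' : Measurable fun z : Space d × Bool => T z.1 := hT.comp measurable_fst
  refine Measurable.ite (measurable_snd (measurableSet_singleton true)) ?_ hT'
  exact (measurable_of_finite Bool.not).comp hT'

theorem measurable_uncurry_margin {d : ℕ} {r : ℝ} {f : Space d → ℝ} (hf : Measurable f)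
    {L : Space d × Bool → Label} (hL : Measurable L) (a : Label) :
    Measurable (Function.uncurry (margin r f L a)) := by
  refine Measurable.ite ?_ (Measurable.ite (.inter ?_ ?_) measurable_const measurable_const)
    measurable_const
  · exact measurableSet_le (f := fun q : (Space d × Bool) × Space d × Bool => dist q.1.1 q.2.1)
      (by fun_prop) measurable_const
  · exact measurableSet_le (f := fun q : (Space d × Bool) × Space d × Bool => f q.1.1)
      (by fun_prop) (by fun_prop)
  · exact (hL.comp measurable_snd) (measurableSet_singleton (!a))

theorem abs_margin_le_one {d : ℕ} (r : ℝ) (f : Space d → ℝ) (L : Space d × Bool → Label)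
    (a : Label) (z z' : Space d × Bool) : |margin r f L a z z'| ≤ 1 := by
  unfold margin
  split_ifs <;> simp

/-- The squared margin is the indicator of the `r`-ball. This variance bound is what makes the final
exponent of order `r ^ d` and not `r ^ (2 * d)`. -/
theorem integral_margin_sq_le {d : ℕ} {η : ℝ} (h0 : 0 ≤ η) (h1 : η ≤ 1) {r : ℝ} (hr : 0 ≤ r)
    (f : Space d → ℝ) (L : Space d × Bool → Label) (a : Label) (z : Space d × Bool) :
    ∫ z', margin r f L a z z' ^ 2 ∂(uniformBall d).prod (noiseBit η) ≤ r ^ d := by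
  have := isProbabilityMeasure_noiseBit h0 h1
  have hsq : (fun z' => margin r f L a z z' ^ 2) =
      (Metric.closedBall z.1 r ×ˢ (Set.univ : Set Bool)).indicator 1 := by
    funext z'
    by_cases h : dist z.1 z'.1 ≤ r
    · rw [Set.indicator_of_mem (by simpa [dist_comm] using h)]
      unfold margin
      split_ifs <;> simp
    · rw [Set.indicator_of_notMem (by simpa [dist_comm] using h)]
      simp [margin, h]
  rw [hsq, integral_indicator_one (Metric.isClosed_closedBall.measurableSet.prod .univ),
    measureReal_prod_prod, probReal_univ, mul_one]
  exact uniformBall_real_closedBall_le _ hr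

/-- The expected margin in terms of the neighbors below `z` and the neighbors not below `z` with
target label `a` and `!a`. -/
theorem integral_margin_eq {d : ℕ} {η : ℝ} (h0 : 0 ≤ η) (h1 : η ≤ 1) (r : ℝ)
    {f : Space d → ℝ} (hf : Measurable f) {T : Space d → Label} (hT : Measurable T) (a : Label)
    (z : Space d × Bool) :
    ∫ z', margin r f (noisyLabel T) a z z' ∂(uniformBall d).prod (noiseBit η) =
      (uniformBall d).real {y | dist z.1 y ≤ r ∧ f y < f z.1} + (1 - 2 * η) *
        ((uniformBall d).real {y | dist z.1 y ≤ r ∧ f z.1 ≤ f y ∧ T y = a} -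
          (uniformBall d).real {y | dist z.1 y ≤ r ∧ f z.1 ≤ f y ∧ T y = !a}) := by
  have := isProbabilityMeasure_noiseBit h0 h1
  have hd : MeasurableSet {y : Space d | dist z.1 y ≤ r} :=
    measurableSet_le (by fun_prop) measurable_const
  have hA : MeasurableSet {y | dist z.1 y ≤ r ∧ f y < f z.1} :=
    hd.inter (measurableSet_lt hf measurable_const)
  have hB : ∀ c, MeasurableSet {y | dist z.1 y ≤ r ∧ f z.1 ≤ f y ∧ T y = c} := fun c =>
    hd.inter ((measurableSet_le measurable_const hf).inter (hT (measurableSet_singleton c)))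
  have hint : Integrable (margin r f (noisyLabel T) a z) ((uniformBall d).prod (noiseBit η)) :=
    Integrable.of_bound (measurable_uncurry_margin hf
      (measurable_noisyLabel hT) a).of_uncurry_left.aestronglyMeasurable 1
      (Filter.Eventually.of_forall fun z' => abs_margin_le_one ..)
  -- Averaging over the noise bit first: a neighbor below `z` counts 1 whatever its noise, any other
  -- counts ±(1 - 2η) according to its target.
  have hpt : ∀ y, ∫ n, margin r f (noisyLabel T) a z (y, n) ∂noiseBit η =
      {y | dist z.1 y ≤ r ∧ f y < f z.1}.indicator 1 y + (1 - 2 * η) *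
        ({y | dist z.1 y ≤ r ∧ f z.1 ≤ f y ∧ T y = a}.indicator 1 y -
          {y | dist z.1 y ≤ r ∧ f z.1 ≤ f y ∧ T y = !a}.indicator 1 y) := by
    intro y
    have hna : (!a) ≠ a := by cases a <;> simp
    rw [integral_noiseBit h0 h1]
    simp only [margin, noisyLabel, Set.indicator_apply, Set.mem_ofPred_eq, Pi.one_apply, if_true,
      Bool.false_eq_true, if_false]
    by_cases hdist : dist z.1 y ≤ r
    · by_cases hfy : f y < f z.1
      · simp [hdist, hfy, not_le.2 hfy]
      · by_cases hTa : T y = a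
        · simp only [hdist, hfy, not_lt.1 hfy, hTa, hna.symm, if_true, if_false, and_true,
            and_false]
          ring
        · have hTa' : T y = !a := by
            revert hTa; cases T y <;> cases a <;> decide
          simp only [hdist, hfy, not_lt.1 hfy, hTa', hna, hna.symm, Bool.not_not, if_true,
            if_false, and_true, and_false]
          ring
    · simp [hdist]
  have hi : ∀ {S : Set (Space d)}, MeasurableSet S →
      Integrable (S.indicator (1 : Space d → ℝ)) (uniformBall d) := fun hS =>
    (integrable_const (1 : ℝ)).indicator hS
  rw [integral_prod _ hint]
  simp_rw [hpt]
  have hsub : Integrable (fun y => (1 - 2 * η) *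
      ({y | dist z.1 y ≤ r ∧ f z.1 ≤ f y ∧ T y = a}.indicator 1 y -
        {y | dist z.1 y ≤ r ∧ f z.1 ≤ f y ∧ T y = !a}.indicator 1 y)) (uniformBall d) :=
    ((hi (hB a)).sub (hi (hB !a))).const_mul _
  rw [integral_add (hi hA) hsub, integral_const_mul,
    integral_sub (hi (hB _)) (hi (hB _)), integral_indicator_one hA,
    integral_indicator_one (hB _), integral_indicator_one (hB _)]

/-- When the region with target label `!a` lies in the half-space `{y | β ≤ ⟪u, y⟫}` with
`0 ≤ β`, the expected margin in favour of `a` is bounded below. -/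
theorem le_integral_margin {d : ℕ} {η : ℝ} (h0 : 0 ≤ η) (h1 : η ≤ 1 / 2) {r : ℝ} (hr : 0 < r)
    (hr1 : r ≤ 1 / 2) {u : Space d} (hu : ‖u‖ = 1) {β : ℝ} (hβ : 0 ≤ β) {T : Space d → Label}
    (hT : Measurable T) {a : Label} (hTa : ∀ y, inner ℝ u y < β → T y = a)
    {z : Space d × Bool} (hz : ‖z.1‖ ≤ 1) :
    2 * phi η * (r / 16) ^ d ≤ ∫ z', margin r (fun y => inner ℝ u y) (noisyLabel T) a z z'
      ∂(uniformBall d).prod (noiseBit η) := by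
  obtain ⟨x, n⟩ := z
  simp only at hz
  rw [integral_margin_eq h0 (by linarith) r (by fun_prop) hT]
  have hna : (!a) ≠ a := by cases a <;> simp
  set q := (r / 16) ^ d with hq
  have hq0 : 0 ≤ q := by positivity
  set A := {y : Space d | dist x y ≤ r ∧ inner ℝ u y < inner ℝ u x} with hA
  set B := {y | dist x y ≤ r ∧ inner ℝ u x ≤ inner ℝ u y ∧ T y = a} with hB
  set C := {y | dist x y ≤ r ∧ inner ℝ u x ≤ inner ℝ u y ∧ T y = !a} with hC
  have hphi1 : phi η ≤ η := min_le_left _ _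
  have hphi2 : phi η ≤ 1 / 2 - η := min_le_right _ _
  have hphi0 : 0 ≤ phi η := le_min h0 (by linarith)
  obtain ⟨p, hp⟩ := exists_closedBall_subset hu hr hr1 hz
  have hp1 : Metric.closedBall p (r / 16) ⊆ Metric.closedBall 0 1 := fun y hy =>
    mem_closedBall_zero_iff.2 (hp y hy).1
  have hA0 : 0 ≤ (uniformBall d).real A := measureReal_nonneg
  -- If `x` is more than `r` below level `β`, its neighborhood contains no target `!a`, and the mean
  -- is at least (1 - 2η)(A + B). Otherwise `⟪u, x⟫ ≥ β - r ≥ -1/2`, so the inner ball lies strictly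
  -- below `x`.
  rcases lt_or_ge (inner ℝ u x) (β - r) with hlt | hge
  · have hC0 : C = ∅ := by
      refine Set.eq_empty_of_forall_notMem fun y hy => ?_
      have h2 := real_inner_le_norm u (y - x)
      rw [hu, one_mul, ← dist_eq_norm, dist_comm, inner_sub_right] at h2
      have h3 : inner ℝ u y < β := by linarith [hy.1]
      exact hna (hy.2.2.symm.trans (hTa y h3))
    have hV : q ≤ (uniformBall d).real (A ∪ B) := by
      refine pow_le_uniformBall_real (by positivity) hp1 fun y hy => ?_
      rcases lt_or_ge (inner ℝ u y) (inner ℝ u x) with h | h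
      · exact Or.inl ⟨(hp y hy).2.1, h⟩
      · refine Or.inr ⟨(hp y hy).2.1, h, ?_⟩
        by_contra hTa
        have : y ∈ C := ⟨(hp y hy).2.1, h, by revert hTa; cases T y <;> cases a <;> decide⟩
        simp [hC0] at this
    have hAB := hV.trans (measureReal_union_le A B)
    rw [hC0, measureReal_empty, sub_zero]
    nlinarith
  · have hAq : q ≤ (uniformBall d).real A := by
      refine pow_le_uniformBall_real (by positivity) hp1 fun y hy => ⟨(hp y hy).2.1, ?_⟩
      exact (hp y hy).2.2 (by linarith)
    have hrefl : (uniformBall d).real C ≤ (uniformBall d).real A + (uniformBall d).real B := by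
      -- The mirror must be above both `x` and the origin, and `C` must lie on or above it. Points
      -- below it are either below `x` or below level `β`, hence in `A ∪ B`.
      set m := max (inner ℝ u x) β with hm
      have hCm : C ⊆ {y | dist x y ≤ r ∧ m < inner ℝ u y} ∪ {y | inner ℝ u y = m} := by
        intro y hy
        have hmy : m ≤ inner ℝ u y := by
          refine max_le hy.2.1 ?_
          by_contra h
          exact hna (hy.2.2.symm.trans (hTa y (not_le.1 h)))
        rcases hmy.lt_or_eq with h | h
        · exact Or.inl ⟨hy.1, h⟩
        · exact Or.inr h.symm
      have hAB : {y | dist x y ≤ r ∧ inner ℝ u y < m} ⊆ A ∪ B := by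
        intro y hy
        rcases lt_or_ge (inner ℝ u y) (inner ℝ u x) with h | h
        · exact Or.inl ⟨hy.1, h⟩
        · exact Or.inr ⟨hy.1, h, hTa y ((lt_max_iff.1 hy.2).resolve_left (not_lt.2 h))⟩
      have i1 := (measureReal_mono (μ := uniformBall d) hCm).trans (measureReal_union_le _ _)
      rw [uniformBall_hyperplane hu, add_zero] at i1
      exact i1.trans ((uniformBall_above_le_below hu (hβ.trans (le_max_right _ _))
        (le_max_left _ _) r).trans
          ((measureReal_mono (μ := uniformBall d) hAB).trans (measureReal_union_le _ _)))
    have e1 : 2 * phi η * q ≤ 2 * η * (uniformBall d).real A := by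
      refine mul_le_mul ?_ hAq hq0 (by linarith)
      linarith
    nlinarith

/-- With t = φ/16^d, t times the mean is at least 2Q while t² times the second moment is at most Q,
where Q = (r/256)^d φ². The constant 256 is 16 · 16: one factor from the inner ball, one from t. -/
theorem integral_exp_margin_le {d : ℕ} {η : ℝ} (h0 : 0 ≤ η) (h1 : η ≤ 1 / 2) {r : ℝ} (hr : 0 < r)
    (hr1 : r ≤ 1 / 2) {u : Space d} (hu : ‖u‖ = 1) {β : ℝ} (hβ : 0 ≤ β) {T : Space d → Label}
    (hT : Measurable T) {a : Label} (hTa : ∀ y, inner ℝ u y < β → T y = a) :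
    ∀ᵐ z ∂(uniformBall d).prod (noiseBit η),
      ∫ z', Real.exp (-(phi η * (1 / 16) ^ d) *
        margin r (fun y => inner ℝ u y) (noisyLabel T) a z z')
        ∂(uniformBall d).prod (noiseBit η) ≤ Real.exp (-((1 / 256 * r) ^ d * phi η ^ 2)) := by
  have := isProbabilityMeasure_noiseBit h0 (by linarith)
  have hae : ∀ᵐ z ∂(uniformBall d).prod (noiseBit η), ‖z.1‖ ≤ 1 :=
    Measure.quasiMeasurePreserving_fst.ae (ae_norm_le_one_uniformBall d)
  filter_upwards [hae] with z hz
  have hphi0 : 0 ≤ phi η := le_min h0 (by linarith)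
  have hphi1 : phi η ≤ 1 := (min_le_left _ _).trans (by linarith)
  have ht0 : 0 ≤ phi η * (1 / 16) ^ d := by positivity
  have ht1 : phi η * (1 / 16) ^ d ≤ 1 :=
    mul_le_one₀ hphi1 (by positivity) (pow_le_one₀ (by norm_num) (by norm_num))
  refine (integral_exp_neg_mul_le _ (measurable_uncurry_margin (by fun_prop)
    (measurable_noisyLabel hT) a).of_uncurry_left (fun z' => abs_margin_le_one ..)
      ht0 ht1).trans (Real.exp_le_exp.2 ?_)
  have h2 := mul_le_mul_of_nonneg_left
    (le_integral_margin h0 h1 hr hr1 hu hβ hT hTa hz) ht0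
  have h3 := mul_le_mul_of_nonneg_left (integral_margin_sq_le h0 (by linarith) hr.le
    (fun y => inner ℝ u y) (noisyLabel T) a z) (sq_nonneg (phi η * (1 / 16) ^ d))
  have e1 : phi η * (1 / 16) ^ d * (2 * phi η * (r / 16) ^ d) =
      2 * ((1 / 256 * r) ^ d * phi η ^ 2) := by
    rw [show (1 / 256 * r : ℝ) = (1 / 16) * (r / 16) by ring, mul_pow]
    ring
  have e2 : (phi η * (1 / 16) ^ d) ^ 2 * r ^ d = (1 / 256 * r) ^ d * phi η ^ 2 := by
    rw [show (1 / 256 * r : ℝ) = (1 / 16) * (1 / 16) * r by ring]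
    simp only [mul_pow]
    generalize (1 / 16 : ℝ) ^ d = k
    ring
  linarith

/-! ### Consensus with high probability -/

theorem le_sensorLaw_consensus {d N : ℕ} {r η δ : ℝ} (hr : 0 < r) (hr1 : r ≤ 1 / 2) (h0 : 0 < η)
    (h1 : η < 1 / 2) (hδ : 0 < δ)
    (hN : 16 / ((1 / 256 * r) ^ d * phi η ^ 2) *
      (Real.log (8 / ((1 / 256 * r) ^ d * phi η ^ 2)) + Real.log (1 / δ)) ≤ (N : ℝ))
    (tie : Label → Label) (w : Space d) (b : ℝ) {u : Space d} (hu : ‖u‖ = 1) {β : ℝ}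
    (hβ : 0 ≤ β) {a : Label} (hTa : ∀ y, inner ℝ u y < β → target w b y = a) :
    1 - δ ≤ (sensorLaw d N η).real {o | ∃ σ : Equiv.Perm (Fin N),
      Monotone (fun k => inner ℝ u (location o (σ k))) ∧
        ∀ i, finalLabels tie r w b o σ i = a} := by
  rcases le_or_gt δ 1 with hδ1 | hδ1
  swap
  · exact le_trans (by linarith) measureReal_nonneg
  have := isProbabilityMeasure_noiseBit h0.le (by linarith)
  have hphi0 : 0 < phi η := lt_min h0 (by linarith)
  have hphi1 : phi η ≤ 1 := (min_le_left _ _).trans (by linarith)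
  have hT : Measurable (target w b) := by
    refine measurable_to_bool ?_
    have : target w b ⁻¹' {true} = {y | b < inner ℝ w y} := by
      ext y; simp [target]
    rw [this]
    exact measurableSet_lt measurable_const (by fun_prop)
  have hQ1 : (1 / 256 * r) ^ d * phi η ^ 2 ≤ 1 :=
    mul_le_one₀ (pow_le_one₀ (by positivity) (by linarith)) (by positivity)
      (pow_le_one₀ hphi0.le hphi1)
  have hmain := le_measureReal_of_sum_erase_pos ((uniformBall d).prod (noiseBit η))
    (measurable_uncurry_margin (r := r) (f := fun y => inner ℝ u y) (by fun_prop)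
      (measurable_noisyLabel hT) a)
    (fun z z' => abs_margin_le_one ..) (t := phi η * (1 / 16) ^ d) (by positivity)
    (Real.exp_pos _).le (integral_exp_margin_le h0.le h1.le hr hr1 hu hβ hT hTa)
    (S := {o : Outcome d N | ∃ σ : Equiv.Perm (Fin N),
      Monotone (fun k => inner ℝ u (location o (σ k))) ∧
        ∀ i, finalLabels tie r w b o σ i = a})
    (fun o ho => exists_perm_finalLabels_eq tie r w b (fun y => inner ℝ u y) a o ho)
  have hnum := natCast_mul_exp_pow_le (by positivity) hQ1 hδ hδ1 hN
  exact le_trans (by linarith) hmain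

end SensorConsensus

theorem mainTheorem2 :
    ∃ c : ℝ, 0 < c ∧
      ∀ (d : ℕ) (_ : 1 ≤ d) (N : ℕ) (r η δ : ℝ) (_ : 0 < r) (_ : r ≤ 1 / 2)
        (_ : 0 < η) (_ : η < 1 / 2) (_ : 0 < δ)
        (_ : 16 / ((c * r) ^ d * SensorConsensus.phi η ^ 2) *
            (Real.log (8 / ((c * r) ^ d * SensorConsensus.phi η ^ 2)) + Real.log (1 / δ)) ≤ (N : ℝ))
        (tie : SensorConsensus.Label → SensorConsensus.Label)
        (w : SensorConsensus.Space d) (_ : w ≠ 0) (b : ℝ),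
        -- Some update order makes all labels equal.
        1 - δ ≤ (SensorConsensus.sensorLaw d N η).real
          {o | ∃ σ : Equiv.Perm (Fin N), ∃ a : SensorConsensus.Label,
            ∀ i, SensorConsensus.finalLabels tie r w b o σ i = a} ∧
        -- For a separator through the origin, the order of increasing `⟪w, x⟫` makes all
        -- labels negative.
        (b = 0 → 1 - δ ≤ (SensorConsensus.sensorLaw d N η).real
          {o | ∃ σ : Equiv.Perm (Fin N),
            Monotone (fun k => inner ℝ w (SensorConsensus.location o (σ k))) ∧
            ∀ i, SensorConsensus.finalLabels tie r w b o σ i = false}) := by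
  refine ⟨1 / 256, by norm_num, ?_⟩
  intro d _ N r η δ hr hr1 h0 h1 hδ hN tie w hw b
  have hw0 : 0 < ‖w‖ := norm_pos_iff.2 hw
  have := SensorConsensus.isProbabilityMeasure_noiseBit h0.le (by linarith)
  have : MeasureTheory.IsProbabilityMeasure (SensorConsensus.sensorLaw d N η) := by
    unfold SensorConsensus.sensorLaw; infer_instance
  have hu : ‖‖w‖⁻¹ • w‖ = 1 := by
    rw [norm_smul, norm_inv, norm_norm, inv_mul_cancel₀ hw0.ne']
  have hinner : ∀ y, inner ℝ (‖w‖⁻¹ • w) y = inner ℝ w y / ‖w‖ := fun y => by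
    rw [real_inner_smul_left, inv_mul_eq_div]
  have hpos : 0 ≤ b → 1 - δ ≤ (SensorConsensus.sensorLaw d N η).real
      {o | ∃ σ : Equiv.Perm (Fin N),
        Monotone (fun k => inner ℝ w (SensorConsensus.location o (σ k))) ∧
        ∀ i, SensorConsensus.finalLabels tie r w b o σ i = false} := by
    intro hb
    refine (SensorConsensus.le_sensorLaw_consensus hr hr1 h0 h1 hδ hN tie w b hu
      (β := b / ‖w‖) (by positivity) (a := false) ?_).trans
      (MeasureTheory.measureReal_mono ?_)
    · intro y hy
      rw [hinner, div_lt_div_iff_of_pos_right hw0] at hy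
      simpa [SensorConsensus.target] using hy.le
    · rintro o ⟨σ, hσ, h⟩
      refine ⟨σ, fun i j hij => ?_, h⟩
      have := hσ hij
      simp only [hinner] at this
      exact (div_le_div_iff_of_pos_right hw0).1 this
  refine ⟨?_, fun hb => hpos hb.ge⟩
  rcases le_or_gt 0 b with hb | hb
  · refine (hpos hb).trans (MeasureTheory.measureReal_mono ?_)
    rintro o ⟨σ, -, h⟩
    exact ⟨σ, false, h⟩
  -- For `b < 0` the origin has a positive target, so the roles swap: update by decreasing `⟪w, x⟫`
  -- and aim for the positive label.
  · refine (SensorConsensus.le_sensorLaw_consensus hr hr1 h0 h1 hδ hN tie w b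
      (u := -(‖w‖⁻¹ • w)) (by rw [norm_neg, hu]) (β := -b / ‖w‖)
      (div_nonneg (by linarith) hw0.le) (a := true) ?_).trans
      (MeasureTheory.measureReal_mono ?_)
    · intro y hy
      rw [inner_neg_left, hinner, ← neg_div, div_lt_div_iff_of_pos_right hw0] at hy
      simpa [SensorConsensus.target] using hy
    · rintro o ⟨σ, -, h⟩
      exact ⟨σ, true, h⟩
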